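/- Let $S^2\subset\mathbb{R}^3$ be the unit sphere. A $5$-point configuration is a list $X=(p_1,\dots,p_5)$ of pairwise distinct points of $S^2$, and for a function $f:(0,2]\to\mathbb{R}$ its $f$-energy is $$\mathcal{E}_f(X)=\sum_{i<j} f(\|p_i-p_j\|).$$ For $s\in\mathbb{R}\setminus\{0\}$ let $R_s(r)=\operatorname{sign}(s)\,r^{-s}$, and for $k=1,2,3,\dots$ let $G_k(r)=(4-r^2)^k$. Put $$G_5^{\flat}=G_5-25G_1,\qquad G_{10}^{\#}=G_{10}+13G_5+68G_2,\qquad G_{10}^{\#\#}=G_{10}+28G_5+102G_2 .$$ Let TBP denote the triangular bi-pyramid: the configuration consisting of the north pole, the south pole, and three points forming an equilateral triangle on the equator. A triple $(\Gamma_2,\Gamma_3,\Gamma_4)$ of functions $(0,2]\to\mathbb{R}$ is called forcing on an interval $I\subset\mathbb{R}$ if every $5$-point configuration $X$ with $\mathcal{E}_{\Gamma_i}(X)>\mathcal{E}_{\Gamma_i}(\mathrm{TBP})$ for $i=2,3,4$ satisfies $\mathcal{E}_{R_s}(X)>\mathcal{E}_{R_s}(\mathrm{TBP})$ for all $s\in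 I$. Then: 1. $(G_2,G_4,G_6)$ is forcing on $(0,6]$. 2. $(G_2,G_5,G_{10}^{\#\#})$ is forcing on $[6,13]$. 3. $(G_2,G_5^{\flat},G_{10}^{\#})$ is forcing on $[13,15.05]$. 4. $(G_2,G_3,G_5)$ is forcing on $(-2,0)$. -/

import Mathlib

/-- An `n`-point configuration on the unit sphere `S²` of Euclidean space `ℝ³`:
a list of `n` pairwise distinct unit vectors. -/
structure SphereConfig (n : ℕ) where
  point : Fin n → EuclideanSpace ℝ (Fin 3)
  norm_point : ∀ i, ‖point i‖ = 1
  injective_point : Function.Injective point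

/-- The total `f`-potential of a configuration: the sum of `f ‖pᵢ - pⱼ‖` over all pairs `i < j`.
Only the values of `f` on `(0, 2]` are used. -/
noncomputable def energy {n : ℕ} (f : ℝ → ℝ) (P : SphereConfig n) : ℝ :=
  ∑ i : Fin n, ∑ j ∈ Finset.Ioi i, f ‖P.point i - P.point j‖

/-- The power law potential `R_s(r) = sign(s) r^{-s}`. -/
noncomputable def powerLaw (s : ℝ) : ℝ → ℝ := fun r => Real.sign s * r ^ (-s)

/-- The potential `G_k(r) = (4 - r²)^k`. -/
def potG (k : ℕ) : ℝ → ℝ := fun r => (4 - r ^ 2) ^ k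

/-- `G₅♭ = G₅ - 25 G₁`. -/
def potGFiveFlat : ℝ → ℝ := fun r => potG 5 r - 25 * potG 1 r

/-- `G₁₀♯ = G₁₀ + 13 G₅ + 68 G₂`. -/
def potGTenSharp : ℝ → ℝ := fun r => potG 10 r + 13 * potG 5 r + 68 * potG 2 r

/-- `G₁₀♯♯ = G₁₀ + 28 G₅ + 102 G₂`. -/
def potGTenSharpSharp : ℝ → ℝ := fun r => potG 10 r + 28 * potG 5 r + 102 * potG 2 r

/-- The points of the triangular bi-pyramid: the two poles and an equilateral triangle on the
equator. -/
noncomputable def tbpPoint : Fin 5 → EuclideanSpace ℝ (Fin 3) :=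
  ![!₂[0, 0, 1], !₂[0, 0, -1], !₂[1, 0, 0], !₂[-1 / 2, √3 / 2, 0], !₂[-1 / 2, -(√3 / 2), 0]]

theorem norm_tbpPoint (i : Fin 5) : ‖tbpPoint i‖ = 1 := by
  have h : (√3 / 2) ^ 2 = (3 / 4 : ℝ) := by
    rw [div_pow, Real.sq_sqrt (by norm_num)]; norm_num
  rw [EuclideanSpace.norm_eq, Real.sqrt_eq_one]
  fin_cases i <;> simp [tbpPoint, Fin.sum_univ_three, h] <;> norm_num

theorem injective_tbpPoint : Function.Injective tbpPoint := by
  have h1 : (1 : ℝ) < √3 := by rw [Real.lt_sqrt] <;> norm_num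
  have h2 : √3 < (2 : ℝ) := by rw [Real.sqrt_lt'] <;> norm_num
  have e : ∀ i, tbpPoint i 0 + 10 * tbpPoint i 1 + 100 * tbpPoint i 2 =
      (![100, -100, 1, -1 / 2 + 5 * √3, -1 / 2 - 5 * √3] : Fin 5 → ℝ) i := by
    intro i
    fin_cases i <;> simp [tbpPoint] <;> ring
  intro i j hij
  have h := e i
  rw [hij, e j] at h
  fin_cases i <;> fin_cases j <;> first
    | rfl
    | (exfalso; norm_num at h; done)
    | (exfalso; simp at h; linarith)

/-- The triangular bi-pyramid (TBP). -/
noncomputable def TBP : SphereConfig 5 where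
  point := tbpPoint
  norm_point := norm_tbpPoint
  injective_point := injective_tbpPoint

/-- The triple of potentials `(Γ₂, Γ₃, Γ₄)` is forcing on the set `I` of exponents: every
`5`-point configuration with more `Γᵢ`-energy than the TBP for `i = 2, 3, 4` has more
`R_s`-energy than the TBP for all `s ∈ I`. -/
def IsForcing (Γ₂ Γ₃ Γ₄ : ℝ → ℝ) (I : Set ℝ) : Prop :=
  ∀ X : SphereConfig 5,
    energy Γ₂ TBP < energy Γ₂ X → energy Γ₃ TBP < energy Γ₃ X → energy Γ₄ TBP < energy Γ₄ X →
      ∀ s ∈ I, energy (powerLaw s) TBP < energy (powerLaw s) X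

/-! The TBP has only the distances 2, √2, √3, that is t = 4 - r² ∈ {0, 2, 1}. Suppose a combination
a₀ + a₁ G₁ + a₂ Γ₂ + a₃ Γ₃ + a₄ Γ₄ with a₁, a₂, a₃ ≥ 0 < a₄ lies below a positive multiple of R_s
and meets it at these three distances. Since the TBP minimizes the G₁-energy
(`energy_potG_one_TBP_le`), summing over pairs gives the forcing property (`isForcing_of_minorant`).

With s = 2u the potential becomes F(t) = (1 - t/4)^(-u) / u, whose Taylor coefficients of degree at
least 1 are nonnegative for u > -1. The minorant Q is the combination of 1, t, t² and two higher
powers that agrees with F at 0 and to second order at 1 and 2. To see Q ≤ F, insert the Hermite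
interpolant H of F, of order K at 0 and order 2 at 1 and 2, with K chosen so that H and Q have the
same nominal degree. Then H ≤ F by positivity of the Taylor coefficients (`hermite_le_of_hasSum`),
and H - Q = t (t-1)² (t-2)² · gap(t) for an explicit polynomial gap.

What remains is the sign of finitely many functions of u: the coefficients of the minorant, and the
coefficients of the gap or combinations of them. Multiplied by u, each has the form a(u) + b(u)
(4/3)^u + c(u) 2^u with rational polynomials a, b, c, and its positivity on the relevant interval is
checked in exact rational arithmetic (`ExpPoly.eval_pos`, `ExpPoly.eval_div_pos`). -/

/-! ### Rational polynomials and computable bounds for them. -/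

/-- Evaluation at a real point of the polynomial with the given list of rational coefficients,
lowest degree first. -/
noncomputable def polyEval (p : List ℚ) (x : ℝ) : ℝ := p.foldr (fun c r => (c : ℝ) + x * r) 0

def polyAdd : List ℚ → List ℚ → List ℚ
  | [], q => q
  | p, [] => p
  | a :: p, b :: q => (a + b) :: polyAdd p q

def polySmul (a : ℚ) (p : List ℚ) : List ℚ := p.map (a * ·)

def polyMul (p q : List ℚ) : List ℚ :=
  p.foldr (fun c r => polyAdd (polySmul c q) (0 :: r)) []

/-- The coefficients of `p (a + x)`. -/
def polyShift (a : ℚ) (p : List ℚ) : List ℚ :=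
  p.foldr (fun c r => polyAdd [c] (polyAdd (polySmul a r) (0 :: r))) []

/-- A bound for `|p|` on `[-1, 1]`. -/
def polyNorm (p : List ℚ) : ℚ := p.foldr (fun c r => |c| + r) 0

/-- A lower bound for `p` on `[0, h]`, by interval arithmetic in Horner form. -/
def hornerLower (h : ℚ) (p : List ℚ) : ℚ :=
  p.foldr (fun c r => if 0 ≤ r then c else c + h * r) 0

@[simp] theorem polyEval_nil (x : ℝ) : polyEval [] x = 0 := rfl

@[simp] theorem polyEval_cons (a : ℚ) (p : List ℚ) (x : ℝ) :
    polyEval (a :: p) x = a + x * polyEval p x := rfl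

theorem polyEval_add (p q : List ℚ) (x : ℝ) :
    polyEval (polyAdd p q) x = polyEval p x + polyEval q x := by
  induction p generalizing q with
  | nil => simp [polyAdd]
  | cons a p ih =>
    cases q with
    | nil => simp [polyAdd]
    | cons b q => simp [polyAdd, ih]; ring

theorem polyEval_smul (a : ℚ) (p : List ℚ) (x : ℝ) :
    polyEval (polySmul a p) x = a * polyEval p x := by
  induction p with
  | nil => simp [polySmul]
  | cons b p ih =>
    simp only [polySmul, List.map_cons, polyEval_cons] at ih ⊢
    rw [ih]; push_cast; ring

theorem polyEval_mul (p q : List ℚ) (x : ℝ) :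
    polyEval (polyMul p q) x = polyEval p x * polyEval q x := by
  induction p with
  | nil => simp [polyMul]
  | cons b p ih =>
    simp only [polyMul, List.foldr_cons, polyEval_add, polyEval_smul, polyEval_cons] at ih ⊢
    rw [ih]; push_cast; ring

theorem polyEval_shift (a : ℚ) (p : List ℚ) (x : ℝ) :
    polyEval (polyShift a p) x = polyEval p (a + x) := by
  induction p with
  | nil => simp [polyShift]
  | cons b p ih =>
    simp only [polyShift, List.foldr_cons, polyEval_add, polyEval_smul, polyEval_cons,
      polyEval_nil] at ih ⊢
    rw [ih]; push_cast; ring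

theorem abs_polyEval_le (p : List ℚ) {x : ℝ} (hx : |x| ≤ 1) : |polyEval p x| ≤ polyNorm p := by
  induction p with
  | nil => simp [polyNorm]
  | cons a p ih =>
    simp only [polyNorm, List.foldr_cons, polyEval_cons] at ih ⊢
    push_cast
    refine (abs_add_le _ _).trans (add_le_add le_rfl ?_)
    rw [abs_mul]
    exact (mul_le_of_le_one_left (abs_nonneg _) hx).trans ih

theorem hornerLower_le (h : ℚ) (p : List ℚ) {x : ℝ} (hx : 0 ≤ x) (hxh : x ≤ h) :
    (hornerLower h p : ℝ) ≤ polyEval p x := by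
  induction p with
  | nil => simp [hornerLower]
  | cons a p ih =>
    simp only [hornerLower, List.foldr_cons, polyEval_cons] at ih ⊢
    set r : ℚ := List.foldr _ 0 p
    split_ifs with hr
    · have : (0 : ℝ) ≤ r := by exact_mod_cast hr
      nlinarith
    · have : (r : ℝ) < 0 := by exact_mod_cast not_le.1 hr
      push_cast
      nlinarith

/-! ### Approximation of (4/3)^x and 2^x with explicit error. -/

/-- An approximation on `[-1, 1]` of `((4 / 3) ^ x - 1) / x`. -/
def fourThirdsQuot : List ℚ :=
  ([28768207, 4138049, 396814, 28539, 1642, 79, 3, 0, 0] : List ℚ).map (· / 10 ^ 8)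

/-- An approximation on `[-1, 1]` of `(2 ^ x - 1) / x`. -/
def twoQuot : List ℚ :=
  ([69314718, 24022651, 5550411, 961813, 133336, 15404, 1525, 132, 10] : List ℚ).map (· / 10 ^ 8)

/-- Factoring x out of the error keeps the value at x = 0 exact, which later permits division at a
zero. The bound 2/10⁸ splits into 6/10⁹ for replacing l by q and 14/10⁹ for the Taylor remainder. -/
theorem exists_exp_mul_eq {l q : ℝ} (hq0 : 0 ≤ q) (hq1 : q ≤ 7 / 10) (hlq : |l - q| ≤ 1 / 10 ^ 9)
    {x : ℝ} (hx : |x| ≤ 1) :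
    ∃ η, Real.exp (x * l) = 1 + x * η ∧
      |η - ∑ k ∈ Finset.range 9, q ^ (k + 1) * x ^ k / (k + 1).factorial| ≤ 2 / 10 ^ 8 := by
  rcases eq_or_ne x 0 with rfl | hx0
  · refine ⟨q, by simp, ?_⟩
    -- At x = 0 every η satisfies the equation; q is the constant term of the sum.
    norm_num [Finset.sum_range_succ]
  refine ⟨(Real.exp (x * l) - 1) / x, by field_simp; ring, ?_⟩
  have hxq : |x * q| ≤ 7 / 10 * |x| := by
    rw [abs_mul, abs_of_nonneg hq0, mul_comm]
    exact mul_le_mul_of_nonneg_right hq1 (abs_nonneg _)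
  have hxq1 : |x * q| ≤ 1 := hxq.trans (by linarith)
  have h1 := Real.exp_bound hxq1 (n := 10) (by norm_num)
  have h2 : |Real.exp (x * l) - Real.exp (x * q)| ≤ |x| * (6 / 10 ^ 9) := by
    have e : Real.exp (x * l) - Real.exp (x * q) =
        Real.exp (x * q) * (Real.exp (x * (l - q)) - 1) := by
      rw [mul_sub, ← Real.exp_add]; ring_nf
    have hs : |x * (l - q)| ≤ |x| * (1 / 10 ^ 9) := by
      rw [abs_mul]; exact mul_le_mul_of_nonneg_left hlq (abs_nonneg _)
    have hs1 : |x * (l - q)| ≤ 1 := hs.trans (by linarith)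
    have h3 := Real.abs_exp_sub_one_le hs1
    have h4 : Real.exp (x * q) ≤ 3 :=
      (Real.exp_le_exp.2 ((le_abs_self _).trans hxq1)).trans Real.exp_one_lt_three.le
    rw [e, abs_mul, abs_of_pos (Real.exp_pos _)]
    have := mul_le_mul h4 (h3.trans (mul_le_mul_of_nonneg_left hs two_pos.le)) (abs_nonneg _)
      (by norm_num)
    linarith
  have h5 : |x * q| ^ 10 ≤ |x| * (3 / 100) := by
    have : |x| ^ 10 ≤ |x| := pow_le_of_le_one (abs_nonneg _) hx (by norm_num)
    calc |x * q| ^ 10 ≤ (7 / 10 * |x|) ^ 10 := by gcongr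
      _ = (7 / 10) ^ 10 * |x| ^ 10 := by ring
      _ ≤ (3 / 100) * |x| := by gcongr; norm_num
      _ = _ := by ring
  have e2 : (Real.exp (x * l) - 1) / x -
      ∑ k ∈ Finset.range 9, q ^ (k + 1) * x ^ k / (k + 1).factorial =
      ((Real.exp (x * l) - Real.exp (x * q)) + (Real.exp (x * q) -
        ∑ k ∈ Finset.range 10, (x * q) ^ k / k.factorial)) / x := by
    have : ∑ k ∈ Finset.range 10, (x * q) ^ k / k.factorial =
        1 + x * ∑ k ∈ Finset.range 9, q ^ (k + 1) * x ^ k / (k + 1).factorial := by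
      rw [Finset.sum_range_succ', Finset.mul_sum, add_comm]
      congr 1
      · simp
      · exact Finset.sum_congr rfl fun k _ => by ring
    rw [this]; field_simp; ring
  rw [e2, abs_div, div_le_iff₀ (abs_pos.2 hx0)]
  refine (abs_add_le _ _).trans ?_
  have h6 : |x * q| ^ 10 * (((10 : ℕ).succ : ℝ) / ((10 : ℕ).factorial * (10 : ℕ))) ≤
      |x| * (3 / 100) * (((10 : ℕ).succ : ℝ) / ((10 : ℕ).factorial * (10 : ℕ))) := by gcongr
  have h7 : (3 / 100 : ℝ) * (((10 : ℕ).succ : ℝ) / ((10 : ℕ).factorial * (10 : ℕ))) ≤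
      14 / 10 ^ 9 := by norm_num [Nat.factorial]
  have h8 := mul_le_mul_of_nonneg_left h7 (abs_nonneg x)
  linarith

theorem exists_rpow_eq_of_close {b q : ℝ} (hb : 0 < b) (hq0 : 0 ≤ q) (hq1 : q ≤ 7 / 10)
    (hlq : |Real.log b - q| ≤ 1 / 10 ^ 9) {p : List ℚ}
    (hp : ∀ x : ℝ, |x| ≤ 1 →
      |(∑ k ∈ Finset.range 9, q ^ (k + 1) * x ^ k / (k + 1).factorial) - polyEval p x| ≤ 8 / 10 ^ 8)
    {x : ℝ} (hx : |x| ≤ 1) :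
    ∃ η, b ^ x = 1 + x * η ∧ |η - polyEval p x| ≤ 1 / 10 ^ 7 := by
  obtain ⟨η, h1, h2⟩ := exists_exp_mul_eq hq0 hq1 hlq hx
  refine ⟨η, by rw [Real.rpow_def_of_pos hb, mul_comm, h1], ?_⟩
  have := abs_sub_le η _ _ |>.trans (add_le_add h2 (hp x hx))
  linarith

theorem abs_sum_sub_le {a b : ℕ → ℝ} {δ : ℝ} (n : ℕ) (h : ∀ k < n, |a k - b k| ≤ δ) {x : ℝ}
    (hx : |x| ≤ 1) :
    |∑ k ∈ Finset.range n, a k * x ^ k - ∑ k ∈ Finset.range n, b k * x ^ k| ≤ n * δ := by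
  rw [← Finset.sum_sub_distrib]
  refine (Finset.abs_sum_le_sum_abs _ _).trans ?_
  have : ∀ k ∈ Finset.range n, |a k * x ^ k - b k * x ^ k| ≤ δ := fun k hk => by
    rw [← sub_mul, abs_mul, abs_pow]
    exact (mul_le_of_le_one_right (abs_nonneg _) (pow_le_one₀ (abs_nonneg _) hx)).trans
      (h k (Finset.mem_range.1 hk))
  simpa using Finset.sum_le_sum this

theorem polyEval_eq_sum (p : List ℚ) (x : ℝ) :
    polyEval p x = ∑ k ∈ Finset.range p.length, (p.getD k 0 : ℝ) * x ^ k := by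
  induction p with
  | nil => simp
  | cons a p ih =>
    rw [polyEval_cons, ih, List.length_cons, Finset.sum_range_succ', Finset.mul_sum, add_comm]
    simp only [List.getD_cons_succ, List.getD_cons_zero, pow_zero, mul_one]
    congr 1
    exact Finset.sum_congr rfl fun k _ => by ring

/-- Nine coefficients, each rounded with error at most 8/10⁹, contribute at most 72/10⁹ on [-1, 1].
-/
theorem abs_taylor_sub_polyEval_le {q : ℝ} {p : List ℚ} (hl : p.length = 9)
    (h : ∀ k < 9, |q ^ (k + 1) / (k + 1).factorial - (p.getD k 0 : ℝ)| ≤ 8 / 10 ^ 9)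
    {x : ℝ} (hx : |x| ≤ 1) :
    |(∑ k ∈ Finset.range 9, q ^ (k + 1) * x ^ k / (k + 1).factorial) - polyEval p x| ≤
      8 / 10 ^ 8 := by
  have := abs_sum_sub_le 9 h hx
  rw [polyEval_eq_sum, hl]
  calc _ = |∑ k ∈ Finset.range 9, q ^ (k + 1) / (k + 1).factorial * x ^ k -
        ∑ k ∈ Finset.range 9, (p.getD k 0 : ℝ) * x ^ k| := by
        congr 2; exact Finset.sum_congr rfl fun k _ => by ring
    _ ≤ _ := this
    _ ≤ _ := by norm_num

theorem exists_fourThirds_rpow_eq {x : ℝ} (hx : |x| ≤ 1) :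
    ∃ η, (4 / 3 : ℝ) ^ x = 1 + x * η ∧ |η - polyEval fourThirdsQuot x| ≤ 1 / 10 ^ 7 := by
  refine exists_rpow_eq_of_close (q := 0.28768207245) (by norm_num) (by norm_num) (by norm_num) ?_
    (fun x hx => abs_taylor_sub_polyEval_le rfl ?_ hx) hx
  · rw [Real.log_div (by norm_num) (by norm_num), Real.log_four_eq, abs_le]
    constructor <;> linarith [Real.log_two_gt_d9, Real.log_two_lt_d9, Real.log_three_gt_d9,
      Real.log_three_lt_d9]
  · intro k hk
    interval_cases k <;> norm_num [fourThirdsQuot, Nat.factorial, abs_le]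

theorem exists_two_rpow_eq {x : ℝ} (hx : |x| ≤ 1) :
    ∃ η, (2 : ℝ) ^ x = 1 + x * η ∧ |η - polyEval twoQuot x| ≤ 1 / 10 ^ 7 := by
  refine exists_rpow_eq_of_close (q := 0.6931471805) (by norm_num) (by norm_num) (by norm_num) ?_
    (fun x hx => abs_taylor_sub_polyEval_le rfl ?_ hx) hx
  · rw [abs_le]
    constructor <;> linarith [Real.log_two_gt_d9, Real.log_two_lt_d9]
  · intro k hk
    interval_cases k <;> norm_num [twoQuot, Nat.factorial, abs_le]

/-! ### Certified positivity of exponential polynomials. -/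

/-- A linear combination `a(u) + b(u) (4/3)^u + c(u) 2^u` with polynomial coefficients. -/
structure ExpPoly where
  a : List ℚ
  b : List ℚ
  c : List ℚ

namespace ExpPoly

noncomputable def eval (f : ExpPoly) (u : ℝ) : ℝ :=
  polyEval f.a u + polyEval f.b u * (4 / 3 : ℝ) ^ u + polyEval f.c u * (2 : ℝ) ^ u

def neg (f : ExpPoly) : ExpPoly := ⟨polySmul (-1) f.a, polySmul (-1) f.b, polySmul (-1) f.c⟩

theorem eval_neg (f : ExpPoly) (u : ℝ) : f.neg.eval u = -f.eval u := by
  simp only [eval, neg, polyEval_smul]; push_cast; ring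

/-- The coefficients of `f (m + ·)`. -/
def shift (m : ℤ) (f : ExpPoly) : ExpPoly :=
  ⟨polyShift m f.a, polySmul ((4 / 3) ^ m) (polyShift m f.b), polySmul (2 ^ m) (polyShift m f.c)⟩

theorem eval_shift (m : ℤ) (f : ExpPoly) (v : ℝ) : (f.shift m).eval v = f.eval (m + v) := by
  simp only [eval, shift, polyEval_smul, polyEval_shift]
  rw [Real.rpow_add (by norm_num), Real.rpow_add (by norm_num), Real.rpow_intCast,
    Real.rpow_intCast]
  push_cast; ring

def constPart (f : ExpPoly) : List ℚ := polyAdd f.a (polyAdd f.b f.c)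

/-- Substituting 1 + v·η for the two exponentials makes `constPart` the exact part and `quotPart`
the approximate cofactor of v. Shifting by an integer beforehand keeps all coefficients rational. -/
def quotPart (f : ExpPoly) : List ℚ :=
  polyAdd (polyMul f.b fourThirdsQuot) (polyMul f.c twoQuot)

def error (f : ExpPoly) : ℚ := (polyNorm f.b + polyNorm f.c) / 10 ^ 7

theorem exists_eval_eq (f : ExpPoly) {v : ℝ} (hv : |v| ≤ 1) :
    ∃ η, f.eval v = polyEval f.constPart v + v * η ∧ |η - polyEval f.quotPart v| ≤ f.error := by
  obtain ⟨y, hy, hy'⟩ := exists_fourThirds_rpow_eq hv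
  obtain ⟨z, hz, hz'⟩ := exists_two_rpow_eq hv
  refine ⟨polyEval f.b v * y + polyEval f.c v * z, ?_, ?_⟩
  · simp only [eval, hy, hz, constPart, polyEval_add]; ring
  · have e : polyEval f.b v * y + polyEval f.c v * z - polyEval f.quotPart v =
        polyEval f.b v * (y - polyEval fourThirdsQuot v) +
          polyEval f.c v * (z - polyEval twoQuot v) := by
      simp only [quotPart, polyEval_add, polyEval_mul]; ring
    rw [e]
    refine (abs_add_le _ _).trans ?_
    rw [abs_mul, abs_mul, error]
    have h1 := mul_le_mul (abs_polyEval_le f.b hv) hy' (abs_nonneg _)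
      ((abs_nonneg _).trans (abs_polyEval_le f.b hv))
    have h2 := mul_le_mul (abs_polyEval_le f.c hv) hz' (abs_nonneg _)
      ((abs_nonneg _).trans (abs_polyEval_le f.c hv))
    push_cast
    linarith

/-- A computable sufficient condition for `0 < f (m + v)` for `v ∈ [lo, hi] ⊆ [-1, 1]`. -/
def certifyPos (f : ExpPoly) (m : ℤ) (lo hi : ℚ) : Bool :=
  let g := f.shift m
  decide (-1 ≤ lo) && decide (hi ≤ 1) && decide
    (g.error < hornerLower (hi - lo) (polyShift lo (polyAdd g.constPart (0 :: g.quotPart))))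

/-- A computable sufficient condition for `0 < f (m + v) / v` for nonzero
`v ∈ [lo, hi] ⊆ [-1, 1]`. -/
def certifyDivPos (f : ExpPoly) (m : ℤ) (lo hi : ℚ) : Bool :=
  let g := f.shift m
  decide (-1 ≤ lo) && decide (hi ≤ 1) && decide (g.constPart.head? = some 0) && decide
    (g.error < hornerLower (hi - lo) (polyShift lo (polyAdd g.constPart.tail g.quotPart)))

theorem eval_pos {f : ExpPoly} {m : ℤ} {lo hi : ℚ} (h : f.certifyPos m lo hi = true) {u : ℝ}
    (hu : u ∈ Set.Icc (m + lo : ℝ) (m + hi)) : 0 < f.eval u := by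
  simp only [certifyPos, Bool.and_eq_true, decide_eq_true_eq] at h
  obtain ⟨⟨h1, h2⟩, h3⟩ := h
  have h1' : (-1 : ℝ) ≤ lo := by exact_mod_cast h1
  have h2' : (hi : ℝ) ≤ 1 := by exact_mod_cast h2
  obtain ⟨hu1, hu2⟩ := hu
  obtain ⟨v, rfl⟩ : ∃ v, u = m + v := ⟨u - m, by ring⟩
  have hv : |v| ≤ 1 := abs_le.2 ⟨by linarith, by linarith⟩
  obtain ⟨η, e, hη⟩ := (f.shift m).exists_eval_eq hv
  rw [← eval_shift, e]
  have h4 := hornerLower_le (hi - lo) (polyShift lo (polyAdd (f.shift m).constPart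
    (0 :: (f.shift m).quotPart))) (x := v - lo) (by linarith) (by push_cast; linarith)
  rw [polyEval_shift, add_sub_cancel, polyEval_add, polyEval_cons] at h4
  have h5 : ((f.shift m).error : ℝ) < _ := Rat.cast_lt.2 h3
  have h6 : |v * (η - polyEval (f.shift m).quotPart v)| ≤ (f.shift m).error := by
    rw [abs_mul]
    exact (mul_le_of_le_one_left (abs_nonneg _) hv).trans hη
  have h7 := (abs_le.1 h6).1
  push_cast at h4
  linarith

theorem eval_div_pos {f : ExpPoly} {m : ℤ} {lo hi : ℚ} (h : f.certifyDivPos m lo hi = true) {u : ℝ}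
    (hu : u ∈ Set.Icc (m + lo : ℝ) (m + hi)) (hum : u ≠ m) : 0 < f.eval u / (u - m) := by
  simp only [certifyDivPos, Bool.and_eq_true, decide_eq_true_eq] at h
  obtain ⟨⟨⟨h1, h2⟩, h0⟩, h3⟩ := h
  have h1' : (-1 : ℝ) ≤ lo := by exact_mod_cast h1
  have h2' : (hi : ℝ) ≤ 1 := by exact_mod_cast h2
  obtain ⟨hu1, hu2⟩ := hu
  obtain ⟨v, rfl⟩ : ∃ v, u = m + v := ⟨u - m, by ring⟩
  have hv0 : v ≠ 0 := by rintro rfl; simp at hum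
  have hv : |v| ≤ 1 := abs_le.2 ⟨by linarith, by linarith⟩
  obtain ⟨η, e, hη⟩ := (f.shift m).exists_eval_eq hv
  have h4 := hornerLower_le (hi - lo) (polyShift lo (polyAdd (f.shift m).constPart.tail
    (f.shift m).quotPart)) (x := v - lo) (by linarith) (by push_cast; linarith)
  rw [polyEval_shift, add_sub_cancel, polyEval_add] at h4
  have h5 : ((f.shift m).error : ℝ) < _ := Rat.cast_lt.2 h3
  have h7 := (abs_le.1 hη).1
  -- The zero at the centre is verified exactly on the rational constant term, so v cancels and the
  -- error bound stays uniform up to the zero.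
  have e0 : polyEval (f.shift m).constPart v = v * polyEval (f.shift m).constPart.tail v := by
    obtain ⟨t, ht⟩ := List.head?_eq_some_iff.1 h0
    rw [ht]; simp
  rw [← eval_shift, e, e0, add_sub_cancel_left, ← mul_add, mul_div_cancel_left₀ _ hv0]
  linarith

end ExpPoly

/-! ### Hermite interpolation of power series from below. -/

/-- The cubic `p` in `t` with `p 1 = g₁`, `p' 1 = g₁'`, `p 2 = g₂`, `2 * p' 2 = g₂'`. -/
noncomputable def cubicHermite (g₁ g₁' g₂ g₂' t : ℝ) : ℝ :=
  (2 * t - 1) * (2 - t) ^ 2 * g₁ + (t - 1) * (2 - t) ^ 2 * g₁' +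
    (t - 1) ^ 2 * (5 - 2 * t) * g₂ + (t - 1) ^ 2 * (t - 2) * (g₂' / 2)

/-- This is the divided difference of t^m at the nodes 1, 1, 2, 2. Passing from m to m + 1 doubles
it and adds 2^m - m - 1. -/
theorem hermite_divided_difference_pow_nonneg (m : ℕ) : 0 ≤ (m : ℝ) + m * 2 ^ m / 2 - 2 * (2 ^ m - 1) := by
  induction m with
  | zero => simp
  | succ m ih =>
    have : (m : ℝ) + 1 ≤ 2 ^ m := by exact_mod_cast Nat.lt_two_pow_self
    push_cast
    rw [pow_succ]
    linarith

theorem exists_pow_eq_cubicHermite_add (m : ℕ) {t : ℝ} (ht : 0 ≤ t) :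
    ∃ S, 0 ≤ S ∧
      t ^ m = cubicHermite 1 m (2 ^ m) (m * 2 ^ m) t + (t - 1) ^ 2 * (t - 2) ^ 2 * S := by
  induction m with
  | zero => exact ⟨0, le_rfl, by simp [cubicHermite]; ring⟩
  | succ m ih =>
    obtain ⟨S, hS, e⟩ := ih
    -- Multiplying the cubic for t^m by t gives a quartic with the right data for t^(m+1). It
    -- exceeds the next cubic by its leading coefficient, the divided difference, times (t-1)²
    -- (t-2)².
    refine ⟨t * S + ((m : ℝ) + m * 2 ^ m / 2 - 2 * (2 ^ m - 1)),
      add_nonneg (mul_nonneg ht hS) (hermite_divided_difference_pow_nonneg m), ?_⟩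
    rw [pow_succ, e, pow_succ]
    simp only [cubicHermite]
    push_cast
    ring

theorem cubicHermite_pow_le (m : ℕ) {t : ℝ} (ht : 0 ≤ t) :
    cubicHermite 1 m (2 ^ m) (m * 2 ^ m) t ≤ t ^ m := by
  obtain ⟨S, hS, e⟩ := exists_pow_eq_cubicHermite_add m ht
  rw [e]
  exact le_add_of_nonneg_right (by positivity)

/-- A power series with nonnegative coefficients from degree `K` on is bounded below on `[0, ∞)`
by its Hermite interpolant at `0` (to order `K`), `1` and `2` (to order `2`). -/
theorem hermite_le_of_hasSum {c : ℕ → ℝ} (K : ℕ) (hc : ∀ n, K ≤ n → 0 ≤ c n) {t F F₁ F₁' F₂ F₂' : ℝ}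
    (ht : 0 ≤ t) (hF : HasSum (fun n => c n * t ^ n) F) (h₁ : HasSum c F₁)
    (h₁' : HasSum (fun n => n * c n) F₁') (h₂ : HasSum (fun n => c n * 2 ^ n) F₂)
    (h₂' : HasSum (fun n => n * c n * 2 ^ n) F₂') :
    ∑ n ∈ Finset.range K, c n * t ^ n + t ^ K * cubicHermite
      (F₁ - ∑ n ∈ Finset.range K, c n)
      (F₁' - ∑ n ∈ Finset.range K, n * c n - K * (F₁ - ∑ n ∈ Finset.range K, c n))
      ((F₂ - ∑ n ∈ Finset.range K, c n * 2 ^ n) / 2 ^ K)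
      ((F₂' - ∑ n ∈ Finset.range K, n * c n * 2 ^ n
        - K * (F₂ - ∑ n ∈ Finset.range K, c n * 2 ^ n)) / 2 ^ K) t ≤ F := by
  -- Drop the first K terms and divide by t^K. The derivative data of the quotient series are Σ (n -
  -- K) cₙ at 1 and Σ (n - K) cₙ 2^(n-K) at 2, and the claim is a termwise comparison of monomials
  -- with their cubics.
  replace hF := (hasSum_nat_add_iff' K).2 hF
  replace h₁ := (hasSum_nat_add_iff' K).2 h₁
  replace h₁' := ((hasSum_nat_add_iff' K).2 h₁').sub (h₁.mul_left (K : ℝ))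
  replace h₂ := (hasSum_nat_add_iff' K).2 h₂
  replace h₂' := (((hasSum_nat_add_iff' K).2 h₂').sub (h₂.mul_left (K : ℝ))).div_const (2 ^ K)
  replace h₂ := h₂.div_const (2 ^ K)
  have key := ((((h₁.mul_left ((2 * t - 1) * (2 - t) ^ 2)).add
    (h₁'.mul_left ((t - 1) * (2 - t) ^ 2))).add
    (h₂.mul_left ((t - 1) ^ 2 * (5 - 2 * t)))).add
    ((h₂'.div_const 2).mul_left ((t - 1) ^ 2 * (t - 2)))).mul_left (t ^ K)
  have := hasSum_le (fun m => ?_) key hF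
  · rw [← le_sub_iff_add_le']
    exact this
  · have h := mul_le_mul_of_nonneg_left (cubicHermite_pow_le m ht)
      (mul_nonneg (hc (m + K) (by omega)) (pow_nonneg ht K))
    have h2 : (2 : ℝ) ^ K ≠ 0 := by positivity
    refine le_trans (le_of_eq ?_) (h.trans (le_of_eq ?_))
    · simp only [cubicHermite]
      rw [pow_add 2 m K]
      push_cast
      field_simp
      ring
    · rw [pow_add]; ring

/-! ### The binomial series of (1 - t/4)^(-u). -/

/-- The Taylor coefficients at `0` of `(1 - t / 4) ^ (-u)`. -/
noncomputable def negBinomCoeff (u : ℝ) (n : ℕ) : ℝ :=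
  (ascPochhammer ℝ n).eval u / (n.factorial * 4 ^ n)

theorem negBinomCoeff_zero (u : ℝ) : negBinomCoeff u 0 = 1 := by simp [negBinomCoeff]

theorem negBinomCoeff_succ (u : ℝ) (n : ℕ) :
    negBinomCoeff u (n + 1) = negBinomCoeff u n * ((u + n) / (4 * (n + 1))) := by
  simp only [negBinomCoeff, ascPochhammer_succ_eval, Nat.factorial_succ, pow_succ]
  push_cast
  field_simp

/-- The coefficient form of d/dt (1 - t/4)^(-u) = (u/4) (1 - t/4)^(-(u+1)). -/
theorem succ_mul_negBinomCoeff (u : ℝ) (n : ℕ) :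
    ((n + 1 : ℕ) : ℝ) * negBinomCoeff u (n + 1) = u / 4 * negBinomCoeff (u + 1) n := by
  have : (ascPochhammer ℝ (n + 1)).eval u = u * (ascPochhammer ℝ n).eval (u + 1) := by
    rw [ascPochhammer_succ_left]; simp
  simp only [negBinomCoeff, this, Nat.factorial_succ, pow_succ]
  push_cast
  field_simp

/-- Division by u cancels the only factor of u (u+1) ⋯ (u+n-1) that can be negative. Degree 0 is
excluded, because 1/u < 0 for negative u. -/
theorem negBinomCoeff_div_nonneg {u : ℝ} (hu : -1 < u) (hu0 : u ≠ 0) {n : ℕ} (hn : 1 ≤ n) :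
    0 ≤ negBinomCoeff u n / u := by
  induction n, hn using Nat.le_induction with
  | base =>
    rw [negBinomCoeff_succ, negBinomCoeff_zero]
    have : (1 : ℝ) * ((u + (0 : ℕ)) / (4 * ((0 : ℕ) + 1))) / u = 1 / 4 := by
      push_cast; field_simp; ring
    rw [this]; norm_num
  | succ n hn ih =>
    rw [negBinomCoeff_succ, mul_div_right_comm]
    have : (1 : ℝ) ≤ n := by exact_mod_cast hn
    exact mul_nonneg ih (div_nonneg (by linarith) (by linarith))

theorem hasSum_negBinomCoeff (u : ℝ) {t : ℝ} (ht : 0 ≤ t) (ht4 : t < 4) :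
    HasSum (fun n => negBinomCoeff u n * t ^ n) ((1 - t / 4) ^ (-u)) := by
  have h := (Real.one_div_one_sub_rpow_hasFPowerSeriesOnBall_zero u).hasSum (y := t / 4) (by
    rw [Metric.mem_eball, edist_zero_right, enorm_eq_nnnorm]
    norm_cast
    rw [← NNReal.coe_lt_coe]
    simp only [coe_nnnorm, Real.norm_eq_abs, NNReal.coe_one]
    rw [abs_of_nonneg (by positivity)]
    linarith)
  simp only [zero_add, FormalMultilinearSeries.ofScalars_apply_eq, smul_eq_mul, one_div] at h
  rw [Real.rpow_neg (by linarith)]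
  convert! h using 2 with n
  have e := Ring.factorial_nsmul_multichoose_eq_ascPochhammer u n
  rw [Polynomial.ascPochhammer_smeval_eq_eval, nsmul_eq_mul] at e
  rw [negBinomCoeff, ← e, Ring.choose, show u + n - 1 - n + 1 = u by ring, div_pow]
  field_simp

theorem hasSum_mul_negBinomCoeff (u : ℝ) {t : ℝ} (ht : 0 ≤ t) (ht4 : t < 4) :
    HasSum (fun n => n * negBinomCoeff u n * t ^ n) (u * t / 4 * (1 - t / 4) ^ (-u - 1)) := by
  refine (hasSum_nat_add_iff' 1).1 ?_
  have := (hasSum_negBinomCoeff (u + 1) ht ht4).mul_left (u * t / 4)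
  simp only [succ_mul_negBinomCoeff]
  simp only [Finset.range_one, Finset.sum_singleton, Nat.cast_zero, zero_mul, sub_zero]
  rw [show -u - 1 = -(u + 1) by ring]
  convert! this using 2 with n
  rw [pow_succ]; ring

/-! ### Energies and the reduction to minorants. -/

theorem energy_TBP (f : ℝ → ℝ) : energy f TBP = f 2 + 6 * f √2 + 3 * f √3 := by
  have h3 : √3 * √3 = 3 := Real.mul_self_sqrt (by norm_num)
  have key : ∀ (i j : Fin 5) (d : ℝ), 0 ≤ d →
      (tbpPoint i 0 - tbpPoint j 0) ^ 2 + (tbpPoint i 1 - tbpPoint j 1) ^ 2 +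
        (tbpPoint i 2 - tbpPoint j 2) ^ 2 = d → ‖tbpPoint i - tbpPoint j‖ = √d := by
    intro i j d _ h
    rw [EuclideanSpace.norm_eq, Fin.sum_univ_three, ← h]
    simp [sq_abs]
  have h4 : √4 = 2 := by
    rw [show (4 : ℝ) = 2 ^ 2 by norm_num, Real.sqrt_sq (by norm_num)]
  have e01 : ‖tbpPoint 0 - tbpPoint 1‖ = 2 := by
    rw [key 0 1 4 (by norm_num) (by simp [tbpPoint]; norm_num), h4]
  have pole : ∀ i j : Fin 5, (i = 0 ∨ i = 1) → (j = 2 ∨ j = 3 ∨ j = 4) →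
      ‖tbpPoint i - tbpPoint j‖ = √2 := by
    rintro i j (rfl | rfl) (rfl | rfl | rfl) <;>
      refine key _ _ 2 (by norm_num) ?_ <;> simp [tbpPoint] <;> nlinarith
  have e23 : ‖tbpPoint 2 - tbpPoint 3‖ = √3 :=
    key _ _ 3 (by norm_num) (by simp [tbpPoint]; nlinarith)
  have e24 : ‖tbpPoint 2 - tbpPoint 4‖ = √3 :=
    key _ _ 3 (by norm_num) (by simp [tbpPoint]; nlinarith)
  have e34 : ‖tbpPoint 3 - tbpPoint 4‖ = √3 :=
    key _ _ 3 (by norm_num) (by simp [tbpPoint])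
  have i0 : Finset.Ioi (0 : Fin 5) = {1, 2, 3, 4} := by decide
  have i1 : Finset.Ioi (1 : Fin 5) = {2, 3, 4} := by decide
  have i2 : Finset.Ioi (2 : Fin 5) = {3, 4} := by decide
  have i3 : Finset.Ioi (3 : Fin 5) = {4} := by decide
  have i4 : Finset.Ioi (4 : Fin 5) = ∅ := by decide
  simp [energy, TBP, Fin.sum_univ_five, i0, i1, i2, i3, i4, e01, e23, e24, e34, pole]
  ring

theorem energy_mono {n : ℕ} (X : SphereConfig n) {f g : ℝ → ℝ}
    (h : ∀ r, 0 < r → r ≤ 2 → f r ≤ g r) : energy f X ≤ energy g X := by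
  refine Finset.sum_le_sum fun i _ => Finset.sum_le_sum fun j hj => h _ ?_ ?_
  · rw [norm_pos_iff, sub_ne_zero]
    exact fun e => (Finset.mem_Ioi.1 hj).ne (X.injective_point e)
  · refine (norm_sub_le _ _).trans ?_
    rw [X.norm_point, X.norm_point]; norm_num

theorem energy_add {n : ℕ} (X : SphereConfig n) (f g : ℝ → ℝ) :
    energy (fun r => f r + g r) X = energy f X + energy g X := by
  simp only [energy, Finset.sum_add_distrib]

theorem energy_const_mul {n : ℕ} (X : SphereConfig n) (a : ℝ) (f : ℝ → ℝ) :
    energy (fun r => a * f r) X = a * energy f X := by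
  simp only [energy, Finset.mul_sum]

theorem energy_const (X : SphereConfig 5) (a : ℝ) : energy (fun _ => a) X = 10 * a := by
  have : ∑ i : Fin 5, (Finset.Ioi i).card = 10 := by decide
  simp only [energy, Finset.sum_const, nsmul_eq_mul]
  rw [← Finset.sum_mul]
  congr 1
  exact_mod_cast this

/-- For unit vectors Σ_{i<j} ‖pᵢ - pⱼ‖² = 25 - ‖Σ pᵢ‖², so the G₁-energy is 15 + ‖Σ pᵢ‖², and the
TBP attains 15. -/
theorem energy_potG_one_TBP_le (X : SphereConfig 5) : energy (potG 1) TBP ≤ energy (potG 1) X := by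
  have hT : energy (potG 1) TBP = 15 := by
    rw [energy_TBP]
    simp only [potG, pow_one, Real.sq_sqrt (show (0 : ℝ) ≤ 2 by norm_num),
      Real.sq_sqrt (show (0 : ℝ) ≤ 3 by norm_num)]
    norm_num
  have i0 : Finset.Ioi (0 : Fin 5) = {1, 2, 3, 4} := by decide
  have i1 : Finset.Ioi (1 : Fin 5) = {2, 3, 4} := by decide
  have i2 : Finset.Ioi (2 : Fin 5) = {3, 4} := by decide
  have i3 : Finset.Ioi (3 : Fin 5) = {4} := by decide
  have i4 : Finset.Ioi (4 : Fin 5) = ∅ := by decide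
  have h := sq_nonneg
    ‖X.point 0 + X.point 1 + X.point 2 + X.point 3 + X.point 4‖
  rw [hT]
  simp [energy, potG, Fin.sum_univ_five, i0, i1, i2, i3, i4, norm_sub_sq_real, X.norm_point]
  simp only [norm_add_sq_real, inner_add_left, X.norm_point] at h
  linarith

theorem isForcing_of_minorant {Γ₂ Γ₃ Γ₄ : ℝ → ℝ} {I : Set ℝ}
    (h : ∀ s ∈ I, ∃ κ a₀ a₁ a₂ a₃ a₄ : ℝ, 0 < κ ∧ 0 ≤ a₁ ∧ 0 ≤ a₂ ∧ 0 ≤ a₃ ∧ 0 < a₄ ∧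
      (∀ r, 0 < r → r ≤ 2 →
        a₀ + a₁ * potG 1 r + a₂ * Γ₂ r + a₃ * Γ₃ r + a₄ * Γ₄ r ≤ κ * powerLaw s r) ∧
      ∀ r, r = 2 ∨ r = √2 ∨ r = √3 →
        κ * powerLaw s r = a₀ + a₁ * potG 1 r + a₂ * Γ₂ r + a₃ * Γ₃ r + a₄ * Γ₄ r) :
    IsForcing Γ₂ Γ₃ Γ₄ I := by
  intro X h₂ h₃ h₄ s hs
  obtain ⟨κ, a₀, a₁, a₂, a₃, a₄, hκ, p₁, p₂, p₃, p₄, hle, heq⟩ := h s hs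
  have hX := energy_mono X hle
  have hT : κ * energy (powerLaw s) TBP = energy
      (fun r => a₀ + a₁ * potG 1 r + a₂ * Γ₂ r + a₃ * Γ₃ r + a₄ * Γ₄ r) TBP := by
    rw [energy_TBP, energy_TBP, ← heq 2 (by simp), ← heq √2 (by simp), ← heq √3 (by simp)]
    ring
  simp only [energy_add, energy_const_mul, energy_const] at hX hT
  have h₁ := mul_le_mul_of_nonneg_left (energy_potG_one_TBP_le X) p₁
  have h₂ := mul_le_mul_of_nonneg_left h₂.le p₂
  have h₃ := mul_le_mul_of_nonneg_left h₃.le p₃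
  have h₄ := mul_lt_mul_of_pos_left h₄ p₄
  refine lt_of_mul_lt_mul_left ?_ hκ.le
  linarith

/-! ### The power law in the variable t. -/

/-- The power law potential, up to scaling, in the variable `t = 4 - r ^ 2`. -/
noncomputable def powerPot (u t : ℝ) : ℝ := (1 - t / 4) ^ (-u) / u

/-- Dividing by u rather than |u| absorbs the sign in R_s, so positive and negative exponents are
treated alike. -/
theorem mul_powerLaw_eq {u r : ℝ} (hu : u ≠ 0) (hr : 0 < r) :
    4 ^ u / |u| * powerLaw (2 * u) r = powerPot u (4 - r ^ 2) := by
  have e : (1 - (4 - r ^ 2) / 4) ^ (-u) = 4 ^ u * r ^ (-(2 * u)) := by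
    rw [show 1 - (4 - r ^ 2) / 4 = r ^ 2 / 4 by ring, Real.div_rpow (by positivity) (by norm_num),
      ← Real.rpow_natCast, ← Real.rpow_mul hr.le, Real.rpow_neg (by norm_num : (0 : ℝ) ≤ 4),
      div_inv_eq_mul, mul_comm]
    congr 2
    push_cast; ring
  rw [powerLaw, powerPot, e]
  rcases lt_or_gt_of_ne hu with h | h
  · rw [Real.sign_of_neg (by linarith), abs_of_neg h]
    field_simp
  · rw [Real.sign_of_pos (by linarith), abs_of_pos h]
    field_simp

theorem isForcing_of_powerPot {Γ₂ Γ₃ Γ₄ γ₂ γ₃ γ₄ : ℝ → ℝ} {I : Set ℝ}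
    (e₂ : ∀ r, Γ₂ r = γ₂ (4 - r ^ 2)) (e₃ : ∀ r, Γ₃ r = γ₃ (4 - r ^ 2))
    (e₄ : ∀ r, Γ₄ r = γ₄ (4 - r ^ 2))
    (h : ∀ s ∈ I, s ≠ 0 ∧ ∃ a₀ a₁ a₂ a₃ a₄ : ℝ, 0 ≤ a₁ ∧ 0 ≤ a₂ ∧ 0 ≤ a₃ ∧ 0 < a₄ ∧
      (∀ t, 0 ≤ t → t < 4 →
        a₀ + a₁ * t + a₂ * γ₂ t + a₃ * γ₃ t + a₄ * γ₄ t ≤ powerPot (s / 2) t) ∧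
      ∀ t, t = 0 ∨ t = 1 ∨ t = 2 →
        powerPot (s / 2) t = a₀ + a₁ * t + a₂ * γ₂ t + a₃ * γ₃ t + a₄ * γ₄ t) :
    IsForcing Γ₂ Γ₃ Γ₄ I := by
  refine isForcing_of_minorant fun s hs => ?_
  obtain ⟨hs0, a₀, a₁, a₂, a₃, a₄, p₁, p₂, p₃, p₄, hle, heq⟩ := h s hs
  have hu : s / 2 ≠ 0 := div_ne_zero hs0 two_ne_zero
  have hpow : ∀ r, 0 < r → 4 ^ (s / 2) / |s / 2| * powerLaw s r = powerPot (s / 2) (4 - r ^ 2) :=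
    fun r hr => by rw [← mul_powerLaw_eq hu hr, mul_div_cancel₀ s two_ne_zero]
  refine ⟨4 ^ (s / 2) / |s / 2|, a₀, a₁, a₂, a₃, a₄, by positivity, p₁, p₂, p₃, p₄,
    fun r hr hr2 => ?_, fun r hr => ?_⟩
  · rw [hpow r hr, e₂, e₃, e₄, potG, pow_one]
    exact hle _ (by nlinarith) (by nlinarith)
  · have hr0 : 0 < r := by rcases hr with rfl | rfl | rfl <;> positivity
    rw [hpow r hr0, e₂, e₃, e₄, potG, pow_one]
    refine heq _ ?_
    rcases hr with rfl | rfl | rfl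
    · left; norm_num
    · right; right; rw [Real.sq_sqrt (by norm_num)]; norm_num
    · right; left; rw [Real.sq_sqrt (by norm_num)]; norm_num

theorem powerPot_zero (u : ℝ) : powerPot u 0 = 1 / u := by simp [powerPot]

theorem powerPot_one (u : ℝ) : powerPot u 1 = (4 / 3) ^ u / u := by
  rw [powerPot, show (1 - 1 / 4 : ℝ) = (4 / 3)⁻¹ by norm_num, Real.inv_rpow (by norm_num),
    Real.rpow_neg (by norm_num), inv_inv]

theorem powerPot_two (u : ℝ) : powerPot u 2 = 2 ^ u / u := by
  rw [powerPot, show (1 - 2 / 4 : ℝ) = 2⁻¹ by norm_num, Real.inv_rpow (by norm_num),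
    Real.rpow_neg (by norm_num), inv_inv]

theorem hasSum_powerPot (u : ℝ) {t : ℝ} (ht : 0 ≤ t) (ht4 : t < 4) :
    HasSum (fun n => negBinomCoeff u n / u * t ^ n) (powerPot u t) := by
  have h := (hasSum_negBinomCoeff u ht ht4).div_const u
  simp only [mul_div_right_comm] at h
  exact h

theorem hasSum_mul_powerPot {u : ℝ} (hu : u ≠ 0) {t : ℝ} (ht : 0 ≤ t) (ht4 : t < 4) :
    HasSum (fun n => n * (negBinomCoeff u n / u) * t ^ n) (t / (4 - t) * (1 - t / 4) ^ (-u)) := by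
  have e : (1 - t / 4) ^ (-u - 1) = (1 - t / 4) ^ (-u) / (1 - t / 4) := by
    rw [Real.rpow_sub_one (by linarith)]
  have h1 : 1 - t / 4 ≠ 0 := by linarith
  have h2 : 4 - t ≠ 0 := by linarith
  have h := (hasSum_mul_negBinomCoeff u ht ht4).div_const u
  have e' : t / (4 - t) * (1 - t / 4) ^ (-u) = u * (t / 4) / u * (1 - t / 4) ^ (-u - 1) := by
    rw [e, show 4 - t = 4 * (1 - t / 4) by ring]
    field_simp
  rw [e']
  convert! h using 1
  · funext n; ring
  · ring

theorem hermite_le_powerPot {u : ℝ} (hu : -1 < u) (hu0 : u ≠ 0) {K : ℕ} (hK : 1 ≤ K) {t : ℝ}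
    (ht : 0 ≤ t) (ht4 : t < 4) {c : ℕ → ℝ} (hc : c = fun n => negBinomCoeff u n / u)
    {F₁ F₁' F₂ F₂' : ℝ} (h₁ : F₁ = (4 / 3) ^ u / u) (h₁' : F₁' = (4 / 3) ^ u / 3)
    (h₂ : F₂ = 2 ^ u / u) (h₂' : F₂' = 2 ^ u) :
    ∑ n ∈ Finset.range K, c n * t ^ n + t ^ K * cubicHermite
      (F₁ - ∑ n ∈ Finset.range K, c n)
      (F₁' - ∑ n ∈ Finset.range K, n * c n - K * (F₁ - ∑ n ∈ Finset.range K, c n))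
      ((F₂ - ∑ n ∈ Finset.range K, c n * 2 ^ n) / 2 ^ K)
      ((F₂' - ∑ n ∈ Finset.range K, n * c n * 2 ^ n
        - K * (F₂ - ∑ n ∈ Finset.range K, c n * 2 ^ n)) / 2 ^ K) t ≤ powerPot u t := by
  have y : ((1 : ℝ) - 1 / 4) ^ (-u) = (4 / 3) ^ u := by
    rw [show (1 - 1 / 4 : ℝ) = (4 / 3)⁻¹ by norm_num, Real.inv_rpow (by norm_num),
      Real.rpow_neg (by norm_num), inv_inv]
  have z : ((1 : ℝ) - 2 / 4) ^ (-u) = 2 ^ u := by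
    rw [show (1 - 2 / 4 : ℝ) = 2⁻¹ by norm_num, Real.inv_rpow (by norm_num),
      Real.rpow_neg (by norm_num), inv_inv]
  have s₁ := hasSum_powerPot u (zero_le_one) (by norm_num : (1 : ℝ) < 4)
  have s₁' := hasSum_mul_powerPot hu0 (zero_le_one) (by norm_num : (1 : ℝ) < 4)
  have s₂ := hasSum_powerPot u (zero_le_two) (by norm_num : (2 : ℝ) < 4)
  have s₂' := hasSum_mul_powerPot hu0 (zero_le_two) (by norm_num : (2 : ℝ) < 4)
  rw [powerPot_one, ← h₁] at s₁
  rw [y, show (1 : ℝ) / (4 - 1) * (4 / 3) ^ u = F₁' by rw [h₁']; ring] at s₁'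
  rw [powerPot_two, ← h₂] at s₂
  rw [z, show (2 : ℝ) / (4 - 2) * 2 ^ u = F₂' by rw [h₂']; ring] at s₂'
  simp only [one_pow, mul_one] at s₁ s₁'
  subst hc
  exact hermite_le_of_hasSum K
    (fun n hn => negBinomCoeff_div_nonneg hu hu0 (hK.trans hn)) ht (hasSum_powerPot u ht ht4)
    s₁ s₁' s₂ s₂'

/-! ### Interpolation coefficients as exponential polynomials in u. -/

namespace ExpPoly

def add (f g : ExpPoly) : ExpPoly := ⟨polyAdd f.a g.a, polyAdd f.b g.b, polyAdd f.c g.c⟩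

def smul (k : ℚ) (f : ExpPoly) : ExpPoly := ⟨polySmul k f.a, polySmul k f.b, polySmul k f.c⟩

theorem eval_add (f g : ExpPoly) (u : ℝ) : (f.add g).eval u = f.eval u + g.eval u := by
  simp only [eval, add, polyEval_add]; ring

theorem eval_smul (k : ℚ) (f : ExpPoly) (u : ℝ) : (f.smul k).eval u = k * f.eval u := by
  simp only [eval, smul, polyEval_smul]; ring

end ExpPoly

/-- `negBinomCoeff u n` as a polynomial in `u`. -/
def negBinomPoly : ℕ → List ℚ
  | 0 => [1]
  | n + 1 => polyMul (negBinomPoly n) [n / (4 * (n + 1)), 1 / (4 * (n + 1))]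

theorem polyEval_negBinomPoly (n : ℕ) (u : ℝ) :
    polyEval (negBinomPoly n) u = negBinomCoeff u n := by
  induction n with
  | zero => simp [negBinomPoly, negBinomCoeff_zero]
  | succ n ih =>
    rw [negBinomPoly, polyEval_mul, ih, negBinomCoeff_succ]
    simp only [polyEval_cons, polyEval_nil]
    push_cast
    field_simp
    ring

def negBinomComb : ℕ → List ℚ → List ℚ
  | _, [] => []
  | n, a :: w => polyAdd (polySmul a (negBinomPoly n)) (negBinomComb (n + 1) w)

/-- `u` times the linear functional `F ↦ ∑ wₙ cₙ(F) + a F(1) + a' F'(1) + b F(2) + b' 2F'(2)`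
evaluated at `F = powerPot u`, where `cₙ(F)` are the Taylor coefficients of `F` at `0`. -/
def hermiteFunctional (w : List ℚ) (a a' b b' : ℚ) : ExpPoly := ⟨negBinomComb 0 w, [a, a' / 3], [b, b']⟩

/-- `∑ wᵢ c (n + i)`. -/
noncomputable def combSum (c : ℕ → ℝ) : ℕ → List ℚ → ℝ
  | _, [] => 0
  | n, a :: w => a * c n + combSum c (n + 1) w

theorem polyEval_negBinomComb_div (u : ℝ) (n : ℕ) (w : List ℚ) :
    polyEval (negBinomComb n w) u / u = combSum (fun n => negBinomCoeff u n / u) n w := by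
  induction w generalizing n with
  | nil => simp [negBinomComb, combSum]
  | cons a w ih =>
    rw [negBinomComb, combSum, ← ih, polyEval_add, polyEval_smul, polyEval_negBinomPoly]
    ring

theorem eval_hermiteFunctional_div {u : ℝ} (hu0 : u ≠ 0) (w : List ℚ) (a a' b b' : ℚ) {c : ℕ → ℝ}
    (hc : c = fun n => negBinomCoeff u n / u)
    {F₁ F₁' F₂ F₂' : ℝ} (h₁ : F₁ = (4 / 3) ^ u / u) (h₁' : F₁' = (4 / 3) ^ u / 3)
    (h₂ : F₂ = 2 ^ u / u) (h₂' : F₂' = 2 ^ u) :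
    (hermiteFunctional w a a' b b').eval u / u =
      combSum c 0 w + a * F₁ + a' * F₁' + b * F₂ + b' * F₂' := by
  rw [hc, ← polyEval_negBinomComb_div, h₁, h₁', h₂, h₂']
  simp only [ExpPoly.eval, hermiteFunctional, polyEval_cons, polyEval_nil]
  push_cast
  field_simp
  ring

/-! ### Interpolation of `powerPot u` in the span of `1, t, t ^ 2, t ^ 4, t ^ 6` -/

/-- The rational weights solve the 5 × 5 linear system given by the values at 0, 1, 2 and the
derivatives at 1 and 2. The last weight multiplies 2F'(2), not F'(2). -/
def interpSixCoeff1 : ExpPoly :=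
  hermiteFunctional [-27/11] (16/11) (-24/11) 1 (-3/22)

def interpSixCoeff2 : ExpPoly :=
  hermiteFunctional [75/44] (-4/33) (94/33) (-19/12) (29/132)

def interpSixCoeff4 : ExpPoly :=
  hermiteFunctional [-3/11] (-13/33) (-49/66) (2/3) (-13/132)

def interpSixCoeff6 : ExpPoly :=
  hermiteFunctional [1/44] (2/33) (5/66) (-1/12) (1/66)

/-- Coefficients of (H - Q) / (t (t-1)² (t-2)²). The weights 1/4, 3/4, … of the Taylor coefficients
come from expanding 1 / ((1-t)² (2-t)²). -/
def interpSixGap0 : ExpPoly :=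
  hermiteFunctional [27/44, 1/4] (-4/11) (6/11) (-1/4) (3/88)

def interpSixGap1 : ExpPoly :=
  hermiteFunctional [249/176, 3/4, 1/4] (-35/33) (61/66) (-17/48) (25/528)

theorem interpSix_le {u : ℝ} (hu : -1 < u) (hu0 : u ≠ 0) {t : ℝ} (ht : 0 ≤ t) (ht4 : t < 4)
    (hgap : 0 ≤ interpSixGap0.eval u / u + interpSixGap1.eval u / u * t) :
    1 / u + interpSixCoeff1.eval u / u * t + interpSixCoeff2.eval u / u * t ^ 2
        + interpSixCoeff4.eval u / u * t ^ 4 + interpSixCoeff6.eval u / u * t ^ 6 ≤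
      powerPot u t := by
  -- Opaque names for the Taylor coefficients and the data at 1 and 2 turn the final identity into a
  -- polynomial identity in atoms.
  obtain ⟨c, hc⟩ : ∃ c : ℕ → ℝ, c = fun n => negBinomCoeff u n / u := ⟨_, rfl⟩
  obtain ⟨F₁, h₁⟩ : ∃ F₁ : ℝ, F₁ = (4 / 3) ^ u / u := ⟨_, rfl⟩
  obtain ⟨F₁', h₁'⟩ : ∃ F₁' : ℝ, F₁' = (4 / 3) ^ u / 3 := ⟨_, rfl⟩
  obtain ⟨F₂, h₂⟩ : ∃ F₂ : ℝ, F₂ = 2 ^ u / u := ⟨_, rfl⟩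
  obtain ⟨F₂', h₂'⟩ : ∃ F₂' : ℝ, F₂' = (2 : ℝ) ^ u := ⟨_, rfl⟩
  -- K = 3 below gives H degree K + 3 = 6, the top exponent of the span.
  have h0 : 1 / u = c 0 := by rw [hc]; simp [negBinomCoeff_zero]
  refine le_trans ?_ (hermite_le_powerPot hu hu0 (K := 3) (by norm_num) ht ht4 hc h₁ h₁' h₂ h₂')
  have hP : 0 ≤ t * (t - 1) ^ 2 * (t - 2) ^ 2 := by positivity
  refine le_trans (le_add_of_nonneg_right (mul_nonneg hP hgap)) (le_of_eq ?_)
  simp only [interpSixCoeff1, interpSixCoeff2, interpSixCoeff4, interpSixCoeff6,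
    interpSixGap0, interpSixGap1,
    eval_hermiteFunctional_div hu0 _ _ _ _ _ hc h₁ h₁' h₂ h₂', combSum, h0]
  simp only [cubicHermite, Finset.sum_range_succ, Finset.sum_range_zero]
  push_cast
  ring

theorem interpSix_eq {u : ℝ} (hu0 : u ≠ 0) {t : ℝ} (ht : t = 0 ∨ t = 1 ∨ t = 2) :
    powerPot u t =
      1 / u + interpSixCoeff1.eval u / u * t + interpSixCoeff2.eval u / u * t ^ 2
        + interpSixCoeff4.eval u / u * t ^ 4 + interpSixCoeff6.eval u / u * t ^ 6 := by
  obtain ⟨c, hc⟩ : ∃ c : ℕ → ℝ, c = fun n => negBinomCoeff u n / u := ⟨_, rfl⟩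
  obtain ⟨F₁, h₁⟩ : ∃ F₁ : ℝ, F₁ = (4 / 3) ^ u / u := ⟨_, rfl⟩
  obtain ⟨F₁', h₁'⟩ : ∃ F₁' : ℝ, F₁' = (4 / 3) ^ u / 3 := ⟨_, rfl⟩
  obtain ⟨F₂, h₂⟩ : ∃ F₂ : ℝ, F₂ = 2 ^ u / u := ⟨_, rfl⟩
  obtain ⟨F₂', h₂'⟩ : ∃ F₂' : ℝ, F₂' = (2 : ℝ) ^ u := ⟨_, rfl⟩
  have h0 : 1 / u = c 0 := by rw [hc]; simp [negBinomCoeff_zero]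
  have e0 : powerPot u 0 = c 0 := by rw [powerPot_zero, h0]
  have e1 : powerPot u 1 = F₁ := by rw [powerPot_one, h₁]
  have e2 : powerPot u 2 = F₂ := by rw [powerPot_two, h₂]
  simp only [interpSixCoeff1, interpSixCoeff2, interpSixCoeff4, interpSixCoeff6,
    eval_hermiteFunctional_div hu0 _ _ _ _ _ hc h₁ h₁' h₂ h₂', combSum, h0]
  push_cast
  rcases ht with rfl | rfl | rfl
  · rw [e0]; ring
  · rw [e1]; ring
  · rw [e2]; ring

/-! ### Interpolation of `powerPot u` in the span of `1, t, t ^ 2, t ^ 5, t ^ 10` -/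

def interpTenCoeff1 : ExpPoly :=
  hermiteFunctional [-24645/11189] (20960/11189) (-16432/11189) (55/167) (-709/22378)

def interpTenCoeff2 : ExpPoly :=
  hermiteFunctional [56885/44756] (-9280/11189) (18208/11189) (-295/668) (1909/44756)

def interpTenCoeff5 : ExpPoly :=
  hermiteFunctional [-771/11189] (-502/11189) (-1793/11189) (19/167) (-251/22378)

def interpTenCoeff10 : ExpPoly :=
  hermiteFunctional [23/44756] (11/11189) (17/11189) (-1/668) (11/44756)

def interpTenGap0 : ExpPoly :=
  hermiteFunctional [24645/44756, 1/4] (-5240/11189) (4108/11189) (-55/668) (709/89512)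

def interpTenGap1 : ExpPoly :=
  hermiteFunctional [3565/2672, 3/4, 1/4] (-200/167) (116/167) (-365/2672) (35/2672)

def interpTenGap2 : ExpPoly :=
  hermiteFunctional [99045/44756, 23/16, 3/4, 1/4] (-23170/11189) (9965/11189) (-95/668) (4853/358048)

def interpTenGap3 : ExpPoly :=
  hermiteFunctional [2240525/716096, 9/4, 23/16, 3/4, 1/4] (-33820/11189) (10798/11189) (-1135/10688) (7141/716096)

def interpTenGap4 : ExpPoly :=
  hermiteFunctional [2918121/716096, 201/64, 9/4, 23/16, 3/4, 1/4] (-44822/11189) (11087/11189) (-739/10688) (9077/1432192)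

def interpTenGap5 : ExpPoly :=
  hermiteFunctional [14443527/2864384, 261/64, 201/64, 9/4, 23/16, 3/4, 1/4] (-55956/11189) (11172/11189) (-1773/42752) (10485/2864384)

theorem interpTen_le {u : ℝ} (hu : -1 < u) (hu0 : u ≠ 0) {t : ℝ} (ht : 0 ≤ t) (ht4 : t < 4)
    (hgap : 0 ≤ interpTenGap0.eval u / u
      + interpTenGap1.eval u / u * t
      + interpTenGap2.eval u / u * t ^ 2
      + interpTenGap3.eval u / u * t ^ 3
      + interpTenGap4.eval u / u * t ^ 4
      + interpTenGap5.eval u / u * t ^ 5) :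
    1 / u + interpTenCoeff1.eval u / u * t + interpTenCoeff2.eval u / u * t ^ 2
        + interpTenCoeff5.eval u / u * t ^ 5 + interpTenCoeff10.eval u / u * t ^ 10 ≤
      powerPot u t := by
  obtain ⟨c, hc⟩ : ∃ c : ℕ → ℝ, c = fun n => negBinomCoeff u n / u := ⟨_, rfl⟩
  obtain ⟨F₁, h₁⟩ : ∃ F₁ : ℝ, F₁ = (4 / 3) ^ u / u := ⟨_, rfl⟩
  obtain ⟨F₁', h₁'⟩ : ∃ F₁' : ℝ, F₁' = (4 / 3) ^ u / 3 := ⟨_, rfl⟩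
  obtain ⟨F₂, h₂⟩ : ∃ F₂ : ℝ, F₂ = 2 ^ u / u := ⟨_, rfl⟩
  obtain ⟨F₂', h₂'⟩ : ∃ F₂' : ℝ, F₂' = (2 : ℝ) ^ u := ⟨_, rfl⟩
  -- K = 7 below gives H degree 10, hence a gap of degree 5.
  have h0 : 1 / u = c 0 := by rw [hc]; simp [negBinomCoeff_zero]
  refine le_trans ?_ (hermite_le_powerPot hu hu0 (K := 7) (by norm_num) ht ht4 hc h₁ h₁' h₂ h₂')
  have hP : 0 ≤ t * (t - 1) ^ 2 * (t - 2) ^ 2 := by positivity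
  refine le_trans (le_add_of_nonneg_right (mul_nonneg hP hgap)) (le_of_eq ?_)
  simp only [interpTenCoeff1, interpTenCoeff2, interpTenCoeff5, interpTenCoeff10,
    interpTenGap0, interpTenGap1, interpTenGap2, interpTenGap3,
    interpTenGap4, interpTenGap5,
    eval_hermiteFunctional_div hu0 _ _ _ _ _ hc h₁ h₁' h₂ h₂', combSum, h0]
  simp only [cubicHermite, Finset.sum_range_succ, Finset.sum_range_zero]
  push_cast
  ring

theorem interpTen_eq {u : ℝ} (hu0 : u ≠ 0) {t : ℝ} (ht : t = 0 ∨ t = 1 ∨ t = 2) :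
    powerPot u t =
      1 / u + interpTenCoeff1.eval u / u * t + interpTenCoeff2.eval u / u * t ^ 2
        + interpTenCoeff5.eval u / u * t ^ 5 + interpTenCoeff10.eval u / u * t ^ 10 := by
  obtain ⟨c, hc⟩ : ∃ c : ℕ → ℝ, c = fun n => negBinomCoeff u n / u := ⟨_, rfl⟩
  obtain ⟨F₁, h₁⟩ : ∃ F₁ : ℝ, F₁ = (4 / 3) ^ u / u := ⟨_, rfl⟩
  obtain ⟨F₁', h₁'⟩ : ∃ F₁' : ℝ, F₁' = (4 / 3) ^ u / 3 := ⟨_, rfl⟩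
  obtain ⟨F₂, h₂⟩ : ∃ F₂ : ℝ, F₂ = 2 ^ u / u := ⟨_, rfl⟩
  obtain ⟨F₂', h₂'⟩ : ∃ F₂' : ℝ, F₂' = (2 : ℝ) ^ u := ⟨_, rfl⟩
  have h0 : 1 / u = c 0 := by rw [hc]; simp [negBinomCoeff_zero]
  have e0 : powerPot u 0 = c 0 := by rw [powerPot_zero, h0]
  have e1 : powerPot u 1 = F₁ := by rw [powerPot_one, h₁]
  have e2 : powerPot u 2 = F₂ := by rw [powerPot_two, h₂]
  simp only [interpTenCoeff1, interpTenCoeff2, interpTenCoeff5, interpTenCoeff10,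
    eval_hermiteFunctional_div hu0 _ _ _ _ _ hc h₁ h₁' h₂ h₂', combSum, h0]
  push_cast
  rcases ht with rfl | rfl | rfl
  · rw [e0]; ring
  · rw [e1]; ring
  · rw [e2]; ring

/-! ### Interpolation of `powerPot u` in the span of `1, t, t ^ 2, t ^ 3, t ^ 5` -/

def interpFiveCoeff1 : ExpPoly :=
  hermiteFunctional [-17/6] (2/3) (-10/3) (13/6) (-1/3)

def interpFiveCoeff2 : ExpPoly :=
  hermiteFunctional [11/4] 2 6 (-19/4) (3/4)

def interpFiveCoeff3 : ExpPoly :=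
  hermiteFunctional [-23/24] (-11/6) (-17/6) (67/24) (-11/24)

def interpFiveCoeff5 : ExpPoly :=
  hermiteFunctional [1/24] (1/6) (1/6) (-5/24) (1/24)

def interpFiveGap0 : ExpPoly :=
  hermiteFunctional [17/24, 1/4] (-1/6) (5/6) (-13/24) (1/12)

theorem interpFive_le {u : ℝ} (hu : -1 < u) (hu0 : u ≠ 0) {t : ℝ} (ht : 0 ≤ t) (ht4 : t < 4)
    (hgap : 0 ≤ interpFiveGap0.eval u / u) :
    1 / u + interpFiveCoeff1.eval u / u * t + interpFiveCoeff2.eval u / u * t ^ 2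
        + interpFiveCoeff3.eval u / u * t ^ 3 + interpFiveCoeff5.eval u / u * t ^ 5 ≤
      powerPot u t := by
  obtain ⟨c, hc⟩ : ∃ c : ℕ → ℝ, c = fun n => negBinomCoeff u n / u := ⟨_, rfl⟩
  obtain ⟨F₁, h₁⟩ : ∃ F₁ : ℝ, F₁ = (4 / 3) ^ u / u := ⟨_, rfl⟩
  obtain ⟨F₁', h₁'⟩ : ∃ F₁' : ℝ, F₁' = (4 / 3) ^ u / 3 := ⟨_, rfl⟩
  obtain ⟨F₂, h₂⟩ : ∃ F₂ : ℝ, F₂ = 2 ^ u / u := ⟨_, rfl⟩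
  obtain ⟨F₂', h₂'⟩ : ∃ F₂' : ℝ, F₂' = (2 : ℝ) ^ u := ⟨_, rfl⟩
  -- K = 2 below gives H degree 5, hence a constant gap.
  have h0 : 1 / u = c 0 := by rw [hc]; simp [negBinomCoeff_zero]
  refine le_trans ?_ (hermite_le_powerPot hu hu0 (K := 2) (by norm_num) ht ht4 hc h₁ h₁' h₂ h₂')
  have hP : 0 ≤ t * (t - 1) ^ 2 * (t - 2) ^ 2 := by positivity
  refine le_trans (le_add_of_nonneg_right (mul_nonneg hP hgap)) (le_of_eq ?_)
  simp only [interpFiveCoeff1, interpFiveCoeff2, interpFiveCoeff3, interpFiveCoeff5,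
    interpFiveGap0,
    eval_hermiteFunctional_div hu0 _ _ _ _ _ hc h₁ h₁' h₂ h₂', combSum, h0]
  simp only [cubicHermite, Finset.sum_range_succ, Finset.sum_range_zero]
  push_cast
  ring

theorem interpFive_eq {u : ℝ} (hu0 : u ≠ 0) {t : ℝ} (ht : t = 0 ∨ t = 1 ∨ t = 2) :
    powerPot u t =
      1 / u + interpFiveCoeff1.eval u / u * t + interpFiveCoeff2.eval u / u * t ^ 2
        + interpFiveCoeff3.eval u / u * t ^ 3 + interpFiveCoeff5.eval u / u * t ^ 5 := by
  obtain ⟨c, hc⟩ : ∃ c : ℕ → ℝ, c = fun n => negBinomCoeff u n / u := ⟨_, rfl⟩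
  obtain ⟨F₁, h₁⟩ : ∃ F₁ : ℝ, F₁ = (4 / 3) ^ u / u := ⟨_, rfl⟩
  obtain ⟨F₁', h₁'⟩ : ∃ F₁' : ℝ, F₁' = (4 / 3) ^ u / 3 := ⟨_, rfl⟩
  obtain ⟨F₂, h₂⟩ : ∃ F₂ : ℝ, F₂ = 2 ^ u / u := ⟨_, rfl⟩
  obtain ⟨F₂', h₂'⟩ : ∃ F₂' : ℝ, F₂' = (2 : ℝ) ^ u := ⟨_, rfl⟩
  have h0 : 1 / u = c 0 := by rw [hc]; simp [negBinomCoeff_zero]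
  have e0 : powerPot u 0 = c 0 := by rw [powerPot_zero, h0]
  have e1 : powerPot u 1 = F₁ := by rw [powerPot_one, h₁]
  have e2 : powerPot u 2 = F₂ := by rw [powerPot_two, h₂]
  simp only [interpFiveCoeff1, interpFiveCoeff2, interpFiveCoeff3, interpFiveCoeff5,
    eval_hermiteFunctional_div hu0 _ _ _ _ _ hc h₁ h₁' h₂ h₂', combSum, h0]
  push_cast
  rcases ht with rfl | rfl | rfl
  · rw [e0]; ring
  · rw [e1]; ring
  · rw [e2]; ring

/-! ### Certificates on the four ranges of u. -/

namespace ExpPoly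

/-- At u = 0 the function u·F is the constant 1, which is annihilated by every functional used here.
The certificate near 0 is therefore for the quotient by u. -/
theorem div_pos_of_certify_Ioc {f : ExpPoly} (h₀ : f.certifyDivPos 0 0 1 = true)
    (h₂ : f.certifyPos 2 (-1) 1 = true) {u : ℝ} (hu0 : 0 < u) (hu : u ≤ 3) : 0 < f.eval u / u := by
  rcases le_total u 1 with h | h
  · simpa using eval_div_pos h₀ (u := u) ⟨by simpa using hu0.le, by simpa using h⟩
      (by simpa using hu0.ne')
  · exact div_pos (eval_pos h₂ ⟨by norm_num; linarith, by norm_num; linarith⟩) hu0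

theorem div_pos_of_certify_three {f : ExpPoly} (h₄ : f.certifyPos 4 (-1) 1 = true)
    (h₆ : f.certifyPos 6 (-1) (1 / 2) = true) {u : ℝ} (hu3 : 3 ≤ u) (hu : u ≤ 13 / 2) :
    0 < f.eval u / u := by
  refine div_pos ?_ (by linarith)
  rcases le_total u 5 with h | h
  · exact eval_pos h₄ ⟨by norm_num; linarith, by norm_num; linarith⟩
  · exact eval_pos h₆ ⟨by norm_num; linarith, by norm_num; linarith⟩

theorem div_pos_of_certify_seven {f : ExpPoly} (h₇ : f.certifyPos 7 (-1 / 2) (21 / 40) = true)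
    {u : ℝ} (hu7 : 13 / 2 ≤ u) (hu : u ≤ 301 / 40) : 0 < f.eval u / u :=
  div_pos (eval_pos h₇ ⟨by norm_num; linarith, by norm_num; linarith⟩) (by linarith)

theorem div_pos_of_neg_pos {f : ExpPoly} {u : ℝ} (hu : u < 0) (h : 0 < f.neg.eval u) :
    0 < f.eval u / u :=
  div_pos_of_neg_of_neg (by rw [eval_neg] at h; linarith) hu

theorem div_pos_of_certify_zero {f : ExpPoly} (h₀ : f.certifyDivPos 0 (-1 / 2) 0 = true)
    {u : ℝ} (hu : -1 / 2 ≤ u) (hu0 : u < 0) : 0 < f.eval u / u := by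
  simpa using eval_div_pos h₀ (u := u) ⟨by push_cast; linarith, by push_cast; linarith⟩
    (by simpa using hu0.ne)

/-- At u = -1 the potential is affine in t, so functionals that annihilate affine functions vanish
there as well; the second certificate divides by u + 1. -/
theorem div_pos_of_certify_Ioo {f : ExpPoly} (h₀ : f.certifyDivPos 0 (-1 / 2) 0 = true)
    (h₁ : f.neg.certifyDivPos (-1) 0 (1 / 2) = true) {u : ℝ} (hu : -1 < u) (hu0 : u < 0) :
    0 < f.eval u / u := by
  rcases le_total (-1 / 2) u with h | h
  · exact div_pos_of_certify_zero h₀ h hu0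
  · refine div_pos_of_neg_pos hu0 ?_
    have := eval_div_pos h₁ (u := u) ⟨by push_cast; linarith, by push_cast; linarith⟩
      (by push_cast; linarith)
    exact (div_pos_iff_of_pos_right (by push_cast; linarith)).1 this

/-- For the coefficient of t, which does not vanish at u = -1. -/
theorem div_pos_of_certify_Ioo' {f : ExpPoly} (h₀ : f.certifyDivPos 0 (-1 / 2) 0 = true)
    (h₁ : f.neg.certifyPos (-1) 0 (1 / 2) = true) {u : ℝ} (hu : -1 < u) (hu0 : u < 0) :
    0 < f.eval u / u := by
  rcases le_total (-1 / 2) u with h | h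
  · exact div_pos_of_certify_zero h₀ h hu0
  · exact div_pos_of_neg_pos hu0 (eval_pos h₁ ⟨by push_cast; linarith, by push_cast; linarith⟩)

end ExpPoly

/-! ### The four forcing triples. -/

open ExpPoly in
theorem isForcing_potG_two_four_six : IsForcing (potG 2) (potG 4) (potG 6) (Set.Ioc 0 6) := by
  refine isForcing_of_powerPot (γ₂ := fun t => t ^ 2) (γ₃ := fun t => t ^ 4) (γ₄ := fun t => t ^ 6)
    (fun _ => rfl) (fun _ => rfl) (fun _ => rfl) fun s ⟨hs0, hs⟩ => ⟨hs0.ne', ?_⟩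
  obtain ⟨u, hu⟩ : ∃ u, u = s / 2 := ⟨_, rfl⟩
  rw [← hu]
  have hu0 : 0 < u := by linarith
  have hu3 : u ≤ 3 := by linarith
  refine ⟨1 / u, interpSixCoeff1.eval u / u, interpSixCoeff2.eval u / u, interpSixCoeff4.eval u / u,
    interpSixCoeff6.eval u / u,
    (div_pos_of_certify_Ioc (by decide +kernel) (by decide +kernel) hu0 hu3).le,
    (div_pos_of_certify_Ioc (by decide +kernel) (by decide +kernel) hu0 hu3).le,
    (div_pos_of_certify_Ioc (by decide +kernel) (by decide +kernel) hu0 hu3).le,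
    div_pos_of_certify_Ioc (by decide +kernel) (by decide +kernel) hu0 hu3,
    fun t ht ht4 => interpSix_le (by linarith) hu0.ne' ht ht4 ?_,
    fun t ht => interpSix_eq hu0.ne' ht⟩
  have g₀ : 0 < interpSixGap0.eval u / u :=
    div_pos_of_certify_Ioc (by decide +kernel) (by decide +kernel) hu0 hu3
  have g₁ : 0 < interpSixGap1.eval u / u :=
    div_pos_of_certify_Ioc (by decide +kernel) (by decide +kernel) hu0 hu3
  positivity

/-- Here d₂ and d₃ may be negative. On [0, 4] one has t² ≤ 4t and t³ ≤ 2t + t⁴/3, so their negative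
parts are charged to the linear and quartic terms; the mixed hypotheses cover the sign patterns. -/
theorem quintic_nonneg {d₀ d₁ d₂ d₃ d₄ d₅ t : ℝ} (h₀ : 0 ≤ d₀) (h₁ : 0 ≤ d₁) (h₄ : 0 ≤ d₄)
    (h₅ : 0 ≤ d₅) (h₁₂ : 0 ≤ d₁ + 4 * d₂) (h₁₃ : 0 ≤ d₁ + 2 * d₃)
    (h₁₂₃ : 0 ≤ d₁ + 4 * d₂ + 2 * d₃) (h₃₄ : 0 ≤ d₃ + 3 * d₄) (ht : 0 ≤ t) (ht4 : t ≤ 4) :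
    0 ≤ d₀ + d₁ * t + d₂ * t ^ 2 + d₃ * t ^ 3 + d₄ * t ^ 4 + d₅ * t ^ 5 := by
  have e₂ : min d₂ 0 * (4 * t) ≤ d₂ * t ^ 2 :=
    calc min d₂ 0 * (4 * t) ≤ min d₂ 0 * t ^ 2 :=
          mul_le_mul_of_nonpos_left (by nlinarith) (min_le_right _ _)
      _ ≤ d₂ * t ^ 2 := mul_le_mul_of_nonneg_right (min_le_left _ _) (by positivity)
  have q : t ^ 3 ≤ 2 * t + t ^ 4 / 3 := by
    -- The key is (t + 1)(t - 2)² = t³ - 3t² + 4 ≥ 0.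
    nlinarith [mul_nonneg ht (mul_nonneg (by linarith : (0 : ℝ) ≤ t + 1) (sq_nonneg (t - 2))),
      mul_nonneg ht (sq_nonneg (t - 2)), mul_nonneg ht (sq_nonneg (t - 1))]
  have e₃ : min d₃ 0 * (2 * t + t ^ 4 / 3) ≤ d₃ * t ^ 3 :=
    calc min d₃ 0 * (2 * t + t ^ 4 / 3) ≤ min d₃ 0 * t ^ 3 :=
          mul_le_mul_of_nonpos_left q (min_le_right _ _)
      _ ≤ d₃ * t ^ 3 := mul_le_mul_of_nonneg_right (min_le_left _ _) (by positivity)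
  have f₁ : 0 ≤ d₁ + 4 * min d₂ 0 + 2 * min d₃ 0 := by
    rcases min_cases d₂ 0 with ⟨h, _⟩ | ⟨h, _⟩ <;> rcases min_cases d₃ 0 with ⟨h', _⟩ | ⟨h', _⟩ <;>
      rw [h, h'] <;> linarith
  have f₄ : 0 ≤ d₄ + min d₃ 0 / 3 := by
    rcases min_cases d₃ 0 with ⟨h', _⟩ | ⟨h', _⟩ <;> rw [h'] <;> linarith
  nlinarith [mul_nonneg f₁ ht, mul_nonneg f₄ (pow_nonneg ht 4), mul_nonneg h₅ (pow_nonneg ht 5)]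

open ExpPoly in
theorem isForcing_potGTenSharpSharp :
    IsForcing (potG 2) (potG 5) potGTenSharpSharp (Set.Icc 6 13) := by
  refine isForcing_of_powerPot (γ₂ := fun t => t ^ 2) (γ₃ := fun t => t ^ 5)
    (γ₄ := fun t => t ^ 10 + 28 * t ^ 5 + 102 * t ^ 2)
    (fun _ => rfl) (fun _ => rfl) (fun _ => rfl) fun s ⟨hs6, hs⟩ => ⟨by linarith, ?_⟩
  obtain ⟨u, hu⟩ : ∃ u, u = s / 2 := ⟨_, rfl⟩
  rw [← hu]
  have hu3 : 3 ≤ u := by linarith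
  have hu' : u ≤ 13 / 2 := by linarith
  have hu0 : u ≠ 0 := by linarith
  have p₁ : 0 < interpTenCoeff1.eval u / u :=
    div_pos_of_certify_three (by decide +kernel) (by decide +kernel) hu3 hu'
  -- Rewriting t¹⁰ through the new potential subtracts 102 and 28 times its coefficient from those
  -- of t² and t⁵.
  have p₂ : 0 < (interpTenCoeff2.add (interpTenCoeff10.smul (-102))).eval u / u :=
    div_pos_of_certify_three (by decide +kernel) (by decide +kernel) hu3 hu'
  have p₃ : 0 < (interpTenCoeff5.add (interpTenCoeff10.smul (-28))).eval u / u :=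
    div_pos_of_certify_three (by decide +kernel) (by decide +kernel) hu3 hu'
  have p₄ : 0 < interpTenCoeff10.eval u / u :=
    div_pos_of_certify_three (by decide +kernel) (by decide +kernel) hu3 hu'
  refine ⟨1 / u, _, _, _, _, p₁.le, p₂.le, p₃.le, p₄, fun t ht ht4 => ?_, fun t ht => ?_⟩
  · refine le_trans (le_of_eq ?_) (interpTen_le (by linarith) hu0 ht ht4 ?_)
    · simp only [eval_add, eval_smul]; push_cast; ring
    have g₀ : 0 < interpTenGap0.eval u / u :=
      div_pos_of_certify_three (by decide +kernel) (by decide +kernel) hu3 hu'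
    have g₁ : 0 < interpTenGap1.eval u / u :=
      div_pos_of_certify_three (by decide +kernel) (by decide +kernel) hu3 hu'
    have g₄ : 0 < interpTenGap4.eval u / u :=
      div_pos_of_certify_three (by decide +kernel) (by decide +kernel) hu3 hu'
    have g₅ : 0 < interpTenGap5.eval u / u :=
      div_pos_of_certify_three (by decide +kernel) (by decide +kernel) hu3 hu'
    have g₁₂ : 0 < (interpTenGap1.add (interpTenGap2.smul 4)).eval u / u :=
      div_pos_of_certify_three (by decide +kernel) (by decide +kernel) hu3 hu'
    have g₁₃ : 0 < (interpTenGap1.add (interpTenGap3.smul 2)).eval u / u :=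
      div_pos_of_certify_three (by decide +kernel) (by decide +kernel) hu3 hu'
    have g₁₂₃ : 0 < ((interpTenGap1.add (interpTenGap2.smul 4)).add
        (interpTenGap3.smul 2)).eval u / u := by
      refine div_pos ?_ (by linarith)
      -- Horner interval bounds lose accuracy with length, so [3, 5] is halved for this combination.
      rcases le_total u 4 with h | h
      · exact eval_pos (m := 4) (lo := -1) (hi := 0) (by decide +kernel)
          ⟨by norm_num; linarith, by norm_num; linarith⟩
      rcases le_total u 5 with h | h
      · exact eval_pos (m := 4) (lo := 0) (hi := 1) (by decide +kernel)
          ⟨by norm_num; linarith, by norm_num; linarith⟩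
      · exact eval_pos (m := 6) (lo := -1) (hi := 1 / 2) (by decide +kernel)
          ⟨by norm_num; linarith, by norm_num; linarith⟩
    have g₃₄ : 0 < (interpTenGap3.add (interpTenGap4.smul 3)).eval u / u :=
      div_pos_of_certify_three (by decide +kernel) (by decide +kernel) hu3 hu'
    simp only [eval_add, eval_smul, add_div, mul_div_assoc, Rat.cast_ofNat] at g₁₂ g₁₃ g₁₂₃ g₃₄
    exact quintic_nonneg g₀.le g₁.le g₄.le g₅.le g₁₂.le g₁₃.le g₁₂₃.le g₃₄.le ht ht4.le
  · rw [interpTen_eq hu0 ht]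
    simp only [eval_add, eval_smul]; push_cast; ring

open ExpPoly in
theorem isForcing_potGTenSharp :
    IsForcing (potG 2) potGFiveFlat potGTenSharp (Set.Icc 13 15.05) := by
  refine isForcing_of_powerPot (γ₂ := fun t => t ^ 2) (γ₃ := fun t => t ^ 5 - 25 * t ^ 1)
    (γ₄ := fun t => t ^ 10 + 13 * t ^ 5 + 68 * t ^ 2)
    (fun _ => rfl) (fun _ => rfl) (fun _ => rfl) fun s ⟨hs13, hs⟩ => ⟨by linarith, ?_⟩
  obtain ⟨u, hu⟩ : ∃ u, u = s / 2 := ⟨_, rfl⟩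
  rw [← hu]
  have hu7 : 13 / 2 ≤ u := by linarith
  have hu' : u ≤ 301 / 40 := by norm_num at hs; linarith
  have hu0 : u ≠ 0 := by linarith
  -- Writing t⁵ as (t⁵ - 25t) + 25t adds 25 times the coefficient of the flat potential to that of
  -- t.
  have p₁ : 0 < (interpTenCoeff1.add ((interpTenCoeff5.add (interpTenCoeff10.smul (-13))).smul
      25)).eval u / u := div_pos_of_certify_seven (by decide +kernel) hu7 hu'
  have p₂ : 0 < (interpTenCoeff2.add (interpTenCoeff10.smul (-68))).eval u / u :=
    div_pos_of_certify_seven (by decide +kernel) hu7 hu'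
  have p₃ : 0 < (interpTenCoeff5.add (interpTenCoeff10.smul (-13))).eval u / u :=
    div_pos_of_certify_seven (by decide +kernel) hu7 hu'
  have p₄ : 0 < interpTenCoeff10.eval u / u :=
    div_pos_of_certify_seven (by decide +kernel) hu7 hu'
  refine ⟨1 / u, _, _, _, _, p₁.le, p₂.le, p₃.le, p₄, fun t ht ht4 => ?_, fun t ht => ?_⟩
  · refine le_trans (le_of_eq ?_) (interpTen_le (by linarith) hu0 ht ht4 ?_)
    · simp only [eval_add, eval_smul]; push_cast; ring
    have g₀ : 0 < interpTenGap0.eval u / u :=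
      div_pos_of_certify_seven (by decide +kernel) hu7 hu'
    have g₁ : 0 < interpTenGap1.eval u / u :=
      div_pos_of_certify_seven (by decide +kernel) hu7 hu'
    have g₂ : 0 < interpTenGap2.eval u / u :=
      div_pos_of_certify_seven (by decide +kernel) hu7 hu'
    have g₃ : 0 < interpTenGap3.eval u / u :=
      div_pos_of_certify_seven (by decide +kernel) hu7 hu'
    have g₄ : 0 < interpTenGap4.eval u / u :=
      div_pos_of_certify_seven (by decide +kernel) hu7 hu'
    have g₅ : 0 < interpTenGap5.eval u / u :=
      div_pos_of_certify_seven (by decide +kernel) hu7 hu'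
    positivity
  · rw [interpTen_eq hu0 ht]
    simp only [eval_add, eval_smul]; push_cast; ring

open ExpPoly in
theorem isForcing_potG_two_three_five : IsForcing (potG 2) (potG 3) (potG 5) (Set.Ioo (-2) 0) := by
  refine isForcing_of_powerPot (γ₂ := fun t => t ^ 2) (γ₃ := fun t => t ^ 3) (γ₄ := fun t => t ^ 5)
    (fun _ => rfl) (fun _ => rfl) (fun _ => rfl) fun s ⟨hs, hs0⟩ => ⟨hs0.ne, ?_⟩
  obtain ⟨u, hu⟩ : ∃ u, u = s / 2 := ⟨_, rfl⟩
  rw [← hu]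
  have hu0 : u < 0 := by linarith
  have hu1 : -1 < u := by linarith
  refine ⟨1 / u, interpFiveCoeff1.eval u / u, interpFiveCoeff2.eval u / u,
    interpFiveCoeff3.eval u / u, interpFiveCoeff5.eval u / u,
    (div_pos_of_certify_Ioo' (by decide +kernel) (by decide +kernel) hu1 hu0).le,
    (div_pos_of_certify_Ioo (by decide +kernel) (by decide +kernel) hu1 hu0).le,
    (div_pos_of_certify_Ioo (by decide +kernel) (by decide +kernel) hu1 hu0).le,
    div_pos_of_certify_Ioo (by decide +kernel) (by decide +kernel) hu1 hu0,
    fun t ht ht4 => interpFive_le hu1 hu0.ne ht ht4 ?_,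
    fun t ht => interpFive_eq hu0.ne ht⟩
  have g₀ : 0 < interpFiveGap0.eval u / u :=
    div_pos_of_certify_Ioo (by decide +kernel) (by decide +kernel) hu1 hu0
  positivity

theorem lemma2p1 :
    IsForcing (potG 2) (potG 4) (potG 6) (Set.Ioc 0 6) ∧
    IsForcing (potG 2) (potG 5) potGTenSharpSharp (Set.Icc 6 13) ∧
    IsForcing (potG 2) potGFiveFlat potGTenSharp (Set.Icc 13 15.05) ∧
    IsForcing (potG 2) (potG 3) (potG 5) (Set.Ioo (-2) 0) :=
  ⟨isForcing_potG_two_four_six, isForcing_potGTenSharpSharp, isForcing_potGTenSharp,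
    isForcing_potG_two_three_five⟩
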